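/- Let $s>1$ be an integer, $A=\{0,1,\dots,s-1\}$, and for a sequence $(a_n)_{n\ge 1}$ in $A$ write $\Delta^s_{a_1a_2\dots}=\sum_{n\ge1}a_n s^{-n}$. Let $\sigma_1,\dots,\sigma_m$ ($m\ge1$) be distinct non-empty finite words over $A$ that are uniquely decodable, i.e. whenever $\sigma_{i_1}\sigma_{i_2}\cdots\sigma_{i_p}=\sigma_{j_1}\sigma_{j_2}\cdots\sigma_{j_q}$ as words, then $p=q$ and $i_l=j_l$ for all $l$. Let $E$ be the set of all real numbers $x=\Delta^s_{\sigma_{i_1}\sigma_{i_2}\sigma_{i_3}\dots}$, where $(i_n)_{n\ge1}$ ranges over all sequences in $\{1,\dots,m\}$. For $k\ge 1$ let $N_k$ be the number of words of length $k$ among $\sigma_1,\dots,\sigma_m$, and let $K$ be the maximal length of these words, so that $N_1+\dots+N_K=m$. Then the Hausdorff–Besicovitch dimension $\alpha_0$ of $E$ satisfies $$N_1\left(\frac1s\right)^{\alpha_0}+N_2\left(\frac1s\right)^{2\alpha_0}+\dots+N_K\left(\frac1s\right)^{K\alpha_0}=1.$$ -/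

import Mathlib

/-- The digit sequence `a` is the infinite concatenation `w 0, w 1, w 2, …` of digit blocks:
the block `w n` occupies the positions following those of `w 0, …, w (n - 1)`. -/
def IsBlockConcat {s : ℕ} (w : ℕ → List (Fin s)) (a : ℕ → Fin s) : Prop :=
  ∀ n : ℕ, ∀ i : Fin (w n).length,
    a ((∑ j ∈ Finset.range n, (w j).length) + (i : ℕ)) = (w n).get i

/-- The set of all real numbers having an `s`-adic representation
`0.a₀a₁a₂…` that is an infinite concatenation of blocks from `B`
(repetitions allowed, in arbitrary order). -/
def blockSet (s : ℕ) (B : Finset (List (Fin s))) : Set ℝ :=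
  {x : ℝ | ∃ a : ℕ → Fin s, x = Real.ofDigits a ∧
    ∃ w : ℕ → List (Fin s), (∀ n, w n ∈ B) ∧ IsBlockConcat w a}

/-- The number of `k`-digit blocks in the family `B`. -/
def blockCount {s : ℕ} (B : Finset (List (Fin s))) (k : ℕ) : ℕ :=
  (B.filter (fun σ => σ.length = k)).card

/-!
Let `α` solve `∑ σ ∈ B, s ^ (-α |σ|) = 1`. The weights `s ^ (-α |σ|)` define a probability on `B`,
hence a product measure on sequences of blocks. A finite concatenation of blocks decodes in only one
way, so that the sequences starting with it as a whole number of blocks have mass `s ^ (-α n)`,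
where `n` is its length. A prefix of an infinite concatenation is completed to such a word by at
most `K` letters, so a cylinder of length `n` has mass at most `C s ^ (-α n)`, where `C` counts the
words of length at most `K`, and the mass distribution principle gives `0 < μH[α] E`. The `p`-fold
concatenations of blocks give covers of `E` whose `α`-sums are at most
`(∑ σ ∈ B, s ^ (-α |σ|)) ^ p = 1`, whence `μH[α] E ≤ 1`.
-/

open MeasureTheory Filter Topology
open scoped NNReal ENNReal

section HausdorffMeasure

theorem ennreal_pow_rpow_comm (x : ℝ≥0∞) (n : ℕ) (d : ℝ) : (x ^ n) ^ d = (x ^ d) ^ n := by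
  rw [← ENNReal.rpow_natCast_mul, mul_comm, ENNReal.rpow_mul_natCast]

/-- Mass distribution principle; the factor `b ^ d` pays for rounding diameters up to powers of
`b`. -/
theorem smul_le_hausdorffMeasure_of_ediam_le_pow {X : Type*} [EMetricSpace X] [MeasurableSpace X]
    [BorelSpace X] {μ : Measure X} {b C : ℝ≥0∞} (hb : b < 1) {d : ℝ} (hd : 0 ≤ d)
    (h : ∀ (n : ℕ) (t : Set X), Metric.ediam t ≤ b ^ n → μ t ≤ C * (b ^ d) ^ n) :
    (b ^ d / C) • μ ≤ μH[d] := by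
  refine Measure.le_hausdorffMeasure d _ 1 one_pos fun t ht ↦ ?_
  have scaled {n : ℕ} (hn : Metric.ediam t ≤ b ^ n) :
      ((b ^ d / C) • μ) t ≤ (b ^ (n + 1)) ^ d :=
    calc b ^ d / C * μ t ≤ b ^ d / C * (C * (b ^ d) ^ n) := by gcongr; exact h n t hn
      _ = b ^ d * (C⁻¹ * C) * (b ^ d) ^ n := by rw [div_eq_mul_inv]; ring
      _ ≤ b ^ d * 1 * (b ^ d) ^ n := by gcongr; exact ENNReal.inv_mul_le_one C
      _ = (b ^ (n + 1)) ^ d := by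
        rw [mul_one, ← pow_succ', ennreal_pow_rpow_comm]
  by_cases hall : ∀ n, Metric.ediam t ≤ b ^ n
  · have hpow : Tendsto (fun n : ℕ ↦ b ^ n) atTop (𝓝 0) :=
      ENNReal.tendsto_pow_atTop_nhds_zero_of_lt_one hb
    have hzero : Metric.ediam t = 0 := le_zero_iff.mp (ge_of_tendsto' hpow hall)
    rw [hzero]
    exact ge_of_tendsto' (((ENNReal.continuous_rpow_const (y := d)).tendsto 0).comp
      (hpow.comp (tendsto_add_atTop_nat 1))) fun n ↦ scaled (hall n)
  · push Not at hall
    classical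
    obtain ⟨m, hm⟩ : ∃ m, Nat.find hall = m + 1 := Nat.exists_eq_succ_of_ne_zero fun h0 ↦ by
      have := Nat.find_spec hall
      rw [h0, pow_zero] at this
      exact this.not_ge ht
    have hlt : b ^ (m + 1) < Metric.ediam t := hm ▸ Nat.find_spec hall
    have hle : Metric.ediam t ≤ b ^ m := not_lt.mp (Nat.find_min hall (by omega))
    exact (scaled hle).trans (ENNReal.rpow_le_rpow hlt.le hd)

end HausdorffMeasure

section InitialWord

variable {α : Type*}

/-- The word formed by the first `n` letters of a sequence. -/
def initialWord (a : ℕ → α) (n : ℕ) : List α :=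
  (List.range n).map a

@[simp]
theorem length_initialWord (a : ℕ → α) (n : ℕ) : (initialWord a n).length = n := by
  simp [initialWord]

theorem initialWord_eq_ofFn (a : ℕ → α) (n : ℕ) :
    initialWord a n = List.ofFn fun i : Fin n ↦ a i :=
  List.ext_getElem (by simp) (by simp [initialWord])

theorem initialWord_add (a : ℕ → α) (m n : ℕ) :
    initialWord a (m + n) = initialWord a m ++ initialWord (fun i ↦ a (m + i)) n := by
  simp [initialWord, List.range_add, Function.comp_def]

theorem initialWord_succ (a : ℕ → α) (n : ℕ) :
    initialWord a (n + 1) = initialWord a n ++ [a n] := by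
  simp [initialWord, List.range_succ]

theorem initialWord_inj {a b : ℕ → α} {n : ℕ} :
    initialWord a n = initialWord b n ↔ ∀ i < n, a i = b i := by
  simp [initialWord]

theorem initialWord_length_eq_iff {a : ℕ → α} {l : List α} :
    initialWord a l.length = l ↔ ∀ i : Fin l.length, a i = l.get i := by
  refine ⟨fun h i ↦ ?_, fun h ↦ List.ext_getElem (by simp) fun i _ hi ↦ ?_⟩
  · have := List.getElem_of_eq h (i := i) (by simp)
    simpa [initialWord] using this
  · simpa [initialWord] using h ⟨i, hi⟩

theorem length_flatten_initialWord (w : ℕ → List α) (n : ℕ) :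
    (initialWord w n).flatten.length = ∑ j ∈ Finset.range n, (w j).length := by
  induction n with
  | zero => simp [initialWord]
  | succ n ih => simp [initialWord_succ, Finset.sum_range_succ, ih]

theorem initialWord_isPrefix (a : ℕ → α) {m n : ℕ} (h : m ≤ n) :
    initialWord a m <+: initialWord a n := by
  obtain ⟨k, rfl⟩ := Nat.exists_eq_add_of_le h
  exact ⟨_, (initialWord_add a m k).symm⟩

theorem measurableSet_initialWord_mem {ι : Type*} [Countable ι] [MeasurableSpace ι]
    [MeasurableSingletonClass ι] (n : ℕ) (S : Set (List ι)) :
    MeasurableSet {ω : ℕ → ι | initialWord ω n ∈ S} := by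
  have hrestrict : Measurable fun (ω : ℕ → ι) (i : Fin n) ↦ ω i := by fun_prop
  simp only [initialWord_eq_ofFn]
  exact hrestrict (Set.to_countable {f : Fin n → ι | List.ofFn f ∈ S}).measurableSet

end InitialWord

section Digits

variable {s : ℕ}

/-- The integer whose base `s` digits, leading one first, are the first `n` terms of `a`: the
numbers `0.a₀a₁…` with given `digitIndex a n = k` lie in `[k / s ^ n, (k + 1) / s ^ n]`. -/
def digitIndex (a : ℕ → Fin s) (n : ℕ) : ℕ :=
  Nat.ofDigits s ((initialWord a n).map Fin.val).reverse

theorem digitIndex_succ (a : ℕ → Fin s) (n : ℕ) :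
    digitIndex a (n + 1) = a n + s * digitIndex a n := by
  simp [digitIndex, initialWord_succ, Nat.ofDigits_cons]

theorem initialWord_eq_of_digitIndex_eq (hs : 1 < s) {a b : ℕ → Fin s} {n : ℕ}
    (h : digitIndex a n = digitIndex b n) : initialWord a n = initialWord b n := by
  have hrev := Nat.ofDigits_inj_of_len_eq hs (by simp) (by simp) (by simp) h
  exact List.map_injective_iff.mpr Fin.val_injective (List.reverse_injective hrev)

theorem pow_mul_ofDigits (a : ℕ → Fin s) (n : ℕ) :
    (s : ℝ) ^ n * Real.ofDigits a = digitIndex a n + Real.ofDigits fun i ↦ a (i + n) := by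
  have hs : (s : ℝ) ≠ 0 := by exact_mod_cast (Fin.pos (a 0)).ne'
  induction n with
  | zero => simp [digitIndex, initialWord]
  | succ n ih =>
    have hshift : Real.ofDigits (fun i ↦ a (i + n)) =
        (s : ℝ)⁻¹ * (a n + Real.ofDigits fun i ↦ a (i + (n + 1))) := by
      simpa [Real.ofDigitsTerm, mul_add, mul_comm, add_right_comm _ 1 n, add_assoc] using
        Real.ofDigits_eq_sum_add_ofDigits (fun i ↦ a (i + n)) 1
    rw [pow_succ', mul_assoc, ih, hshift, digitIndex_succ, mul_add, mul_inv_cancel_left₀ hs]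
    push_cast
    ring

theorem digitIndex_le_add_two {a b : ℕ → Fin s} {n : ℕ}
    (h : |Real.ofDigits a - Real.ofDigits b| ≤ ((s : ℝ) ^ n)⁻¹) :
    digitIndex a n ≤ digitIndex b n + 2 := by
  have hs : (0 : ℝ) < s ^ n := by have := Fin.pos (a 0); positivity
  have hscaled : (s : ℝ) ^ n * (Real.ofDigits a - Real.ofDigits b) ≤ 1 := by
    rw [← le_inv_mul_iff₀ hs, mul_one]
    exact (le_abs_self _).trans h
  rw [mul_sub, pow_mul_ofDigits, pow_mul_ofDigits] at hscaled
  have ha := Real.ofDigits_nonneg fun i ↦ a (i + n)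
  have hb := Real.ofDigits_le_one fun i ↦ b (i + n)
  have : (digitIndex a n : ℝ) ≤ digitIndex b n + 2 := by linarith
  exact_mod_cast this

theorem ofReal_inv_natCast_pow (hs : 0 < s) (n : ℕ) :
    ENNReal.ofReal ((s : ℝ) ^ n)⁻¹ = (s : ℝ≥0∞)⁻¹ ^ n := by
  rw [ENNReal.ofReal_inv_of_pos (by positivity), ENNReal.ofReal_pow (by positivity),
    ENNReal.ofReal_natCast, ENNReal.inv_pow]

theorem measure_preimage_ofDigits_le (hs : 1 < s) {P : Measure (ℕ → Fin s)} {n : ℕ} {M : ℝ≥0∞}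
    (hP : ∀ a, P {a' | initialWord a' n = initialWord a n} ≤ M) {t : Set ℝ}
    (ht : Metric.ediam t ≤ (s : ℝ≥0∞)⁻¹ ^ n) : P (Real.ofDigits ⁻¹' t) ≤ 5 * M := by
  rcases (Real.ofDigits (b := s) ⁻¹' t).eq_empty_or_nonempty with hempty | ⟨a, ha⟩
  · simp [hempty]
  have hdist {x y : ℝ} (hx : x ∈ t) (hy : y ∈ t) : |x - y| ≤ ((s : ℝ) ^ n)⁻¹ := by
    have hedist := (Metric.edist_le_ediam_of_mem hx hy).trans ht
    rw [← ofReal_inv_natCast_pow (by omega), edist_dist, Real.dist_eq] at hedist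
    exact (ENNReal.ofReal_le_ofReal_iff (by positivity)).mp hedist
  -- `t` can only meet the level `n` interval of one of its points and its two neighbours per side.
  let I := Finset.Icc (digitIndex a n - 2) (digitIndex a n + 2)
  have hcover : Real.ofDigits ⁻¹' t ⊆ ⋃ k ∈ I, {a' : ℕ → Fin s | digitIndex a' n = k} := by
    intro a' ha'
    have h₁ := digitIndex_le_add_two (hdist ha ha')
    have h₂ := digitIndex_le_add_two (hdist ha' ha)
    simp only [Set.mem_iUnion, Set.mem_ofPred_eq, exists_prop, exists_eq_right', I, Finset.mem_Icc]
    omega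
  have hlevel (k : ℕ) : P {a' | digitIndex a' n = k} ≤ M := by
    rcases {a' : ℕ → Fin s | digitIndex a' n = k}.eq_empty_or_nonempty with hempty | ⟨b, hb⟩
    · simp [hempty]
    · exact (measure_mono fun a' ha' ↦
        initialWord_eq_of_digitIndex_eq hs (Eq.trans ha' hb.symm)).trans (hP b)
  calc P (Real.ofDigits ⁻¹' t) ≤ ∑ k ∈ I, P {a' | digitIndex a' n = k} :=
        (measure_mono hcover).trans (measure_biUnion_finset_le I _)
    _ ≤ I.card • M := Finset.sum_le_card_nsmul _ _ _ fun k _ ↦ hlevel k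
    _ ≤ 5 * M := by
      rw [nsmul_eq_mul]
      gcongr
      have : I.card ≤ 5 := by rw [Nat.card_Icc]; omega
      exact_mod_cast this

theorem hausdorffMeasure_ne_zero_of_measure_initialWord_le (hs : 1 < s)
    {P : Measure (ℕ → Fin s)} {C : ℝ≥0∞} (hC : C ≠ ∞) {d : ℝ} (hd : 0 ≤ d)
    (hP : ∀ n a, P {a' | initialWord a' n = initialWord a n} ≤ C * ((s : ℝ≥0∞)⁻¹ ^ d) ^ n)
    {E : Set ℝ} (hE : P (Real.ofDigits ⁻¹' E) ≠ 0) : μH[d] E ≠ 0 := by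
  have hb : (s : ℝ≥0∞)⁻¹ < 1 := ENNReal.inv_lt_one.mpr (by exact_mod_cast hs)
  have hmeas : Measurable (Real.ofDigits (b := s)) := Real.continuous_ofDigits.measurable
  have hlaw (n : ℕ) (t : Set ℝ) (ht : Metric.ediam t ≤ (s : ℝ≥0∞)⁻¹ ^ n) :
      P.map Real.ofDigits t ≤ 5 * C * ((s : ℝ≥0∞)⁻¹ ^ d) ^ n := by
    rw [← Metric.ediam_closure] at ht
    calc P.map Real.ofDigits t ≤ P.map Real.ofDigits (closure t) := measure_mono subset_closure
      _ = P (Real.ofDigits ⁻¹' closure t) := Measure.map_apply hmeas isClosed_closure.measurableSet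
      _ ≤ 5 * C * ((s : ℝ≥0∞)⁻¹ ^ d) ^ n := by
        rw [mul_assoc]
        exact measure_preimage_ofDigits_le hs (hP n) ht
  have hlower := smul_le_hausdorffMeasure_of_ediam_le_pow hb hd hlaw E
  refine ((ENNReal.mul_pos ?_ ?_).trans_le hlower).ne'
  · exact ENNReal.div_ne_zero.mpr ⟨(ENNReal.rpow_pos (by simp) (by simp; omega)).ne',
      ENNReal.mul_ne_top (by simp) hC⟩
  · exact ((pos_iff_ne_zero.mpr hE).trans_le (Measure.le_map_apply hmeas.aemeasurable E)).ne'

end Digits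

section Code

variable {ι α : Type*} {c : ι → List α}

theorem length_le_length_flatMap (hc : ∀ i, c i ≠ []) (L : List ι) :
    L.length ≤ (L.flatMap c).length := by
  induction L with
  | nil => simp
  | cons i L ih =>
    have := List.length_pos_iff.mpr (hc i)
    simp only [List.flatMap_cons, List.length_append, List.length_cons]
    omega

theorem le_length_flatMap_initialWord (hc : ∀ i, c i ≠ []) (ω : ℕ → ι) (p : ℕ) :
    p ≤ ((initialWord ω p).flatMap c).length := by
  simpa using length_le_length_flatMap hc (initialWord ω p)

/-- The infinite concatenation of the codewords `c (ω 0), c (ω 1), …`. The letter in position `i`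
is read off the first `i + 1` codewords, which together are long enough as none is empty. -/
def encode (c : ι → List α) (hc : ∀ i, c i ≠ []) (ω : ℕ → ι) (i : ℕ) : α :=
  ((initialWord ω (i + 1)).flatMap c)[i]'(le_length_flatMap_initialWord hc ω (i + 1))

theorem initialWord_encode (hc : ∀ i, c i ≠ []) (ω : ℕ → ι) (p : ℕ) :
    initialWord (encode c hc ω) ((initialWord ω p).flatMap c).length =
      (initialWord ω p).flatMap c := by
  refine List.ext_getElem (length_initialWord _ _) fun i _ hi ↦ ?_
  simp only [initialWord, List.getElem_map, List.getElem_range]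
  change ((initialWord ω (i + 1)).flatMap c)[i]'_ = ((initialWord ω p).flatMap c)[i]
  rcases le_total (i + 1) p with h | h
  · exact ((initialWord_isPrefix ω h).flatMap c).getElem _
  · exact (((initialWord_isPrefix ω h).flatMap c).getElem hi).symm

theorem eq_encode_iff {hc : ∀ i, c i ≠ []} {ω : ℕ → ι} {a : ℕ → α} :
    a = encode c hc ω ↔
      ∀ p, initialWord a ((initialWord ω p).flatMap c).length = (initialWord ω p).flatMap c := by
  refine ⟨fun h p ↦ h ▸ initialWord_encode hc ω p, fun h ↦ funext fun i ↦ ?_⟩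
  exact initialWord_inj.mp ((h (i + 1)).trans (initialWord_encode hc ω (i + 1)).symm) i
    (le_length_flatMap_initialWord hc ω (i + 1))

theorem sum_pow_length_flatMap_ofFn [Fintype ι] {R : Type*} [CommSemiring R] (θ : R)
    (p : ℕ) : ∑ t : Fin p → ι, θ ^ ((List.ofFn t).flatMap c).length =
      (∑ i, θ ^ (c i).length) ^ p := by
  rw [Fintype.sum_pow]
  refine Finset.sum_congr rfl fun t _ ↦ ?_
  rw [Finset.prod_pow_eq_pow_sum]
  simp [List.length_flatMap, List.sum_ofFn]

theorem exists_flatMap_initialWord_eq_append (hc : ∀ i, c i ≠ []) {K : ℕ}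
    (hK : ∀ i, (c i).length ≤ K) (ω : ℕ → ι) (n : ℕ) :
    ∃ p v, v.length ≤ K ∧ (initialWord ω p).flatMap c = initialWord (encode c hc ω) n ++ v := by
  classical
  have hex : ∃ p, n ≤ ((initialWord ω p).flatMap c).length :=
    ⟨n, le_length_flatMap_initialWord hc ω n⟩
  obtain ⟨p, hp, hmin⟩ : ∃ p, n ≤ ((initialWord ω p).flatMap c).length ∧
      ∀ q < p, ((initialWord ω q).flatMap c).length < n :=
    ⟨Nat.find hex, Nat.find_spec hex, fun q hq ↦ not_le.mp (Nat.find_min hex hq)⟩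
  have hprefix := initialWord_isPrefix (encode c hc ω) hp
  rw [initialWord_encode] at hprefix
  obtain ⟨v, hv⟩ := hprefix
  have hlen := congrArg List.length hv
  rw [List.length_append, length_initialWord] at hlen
  refine ⟨p, v, ?_, hv.symm⟩
  cases p with
  | zero =>
    have hempty : n = 0 ∧ v = [] := by simpa [initialWord] using hlen
    simp [hempty.2]
  | succ q =>
    have hq := hmin q q.lt_succ_self
    have hω := hK (ω q)
    simp only [initialWord_succ, List.flatMap_append, List.flatMap_singleton,
      List.length_append] at hlen
    omega

theorem flatMap_injective_of_uniquelyDecodable (hinj : Function.Injective c)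
    (hdec : InformationTheory.UniquelyDecodable (Set.range c)) :
    Function.Injective fun L : List ι ↦ L.flatMap c := by
  intro L L' h
  refine List.map_injective_iff.mpr hinj (hdec _ _ ?_ ?_ h) <;> simp

theorem measurable_encode [Countable ι] [MeasurableSpace ι] [MeasurableSingletonClass ι]
    [Countable α] [MeasurableSpace α] [MeasurableSingletonClass α] (hc : ∀ i, c i ≠ []) :
    Measurable (encode c hc) := by
  refine measurable_pi_iff.mpr fun i ↦ measurable_to_countable' fun x ↦ ?_
  convert measurableSet_initialWord_mem (i + 1) {L : List ι | (L.flatMap c)[i]? = some x} using 1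
  ext ω
  have hi := le_length_flatMap_initialWord hc ω (i + 1)
  simp [encode, List.getElem?_eq_getElem hi]

end Code

section BlockSet

variable {s : ℕ}

theorem isBlockConcat_iff {w : ℕ → List (Fin s)} {a : ℕ → Fin s} :
    IsBlockConcat w a ↔
      ∀ p, initialWord a (initialWord w p).flatten.length = (initialWord w p).flatten := by
  have happend (p : ℕ) : (initialWord w (p + 1)).flatten = (initialWord w p).flatten ++ w p := by
    simp [initialWord_succ]
  simp only [IsBlockConcat, ← length_flatten_initialWord]
  constructor
  · intro h p
    induction p with
    | zero => simp [initialWord]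
    | succ p ih =>
      rw [happend, List.length_append, initialWord_add, ih, initialWord_length_eq_iff.mpr (h p)]
  · intro h p
    have hp := h (p + 1)
    rw [happend, List.length_append, initialWord_add, h p] at hp
    exact initialWord_length_eq_iff.mp (List.append_cancel_left hp)

theorem blockSet_eq_range_ofDigits_encode {B : Finset (List (Fin s))}
    (hc : ∀ σ : B, (σ : List (Fin s)) ≠ []) :
    blockSet s B = Set.range fun ω : ℕ → B ↦ Real.ofDigits (encode Subtype.val hc ω) := by
  have hconcat {ω : ℕ → B} {a : ℕ → Fin s} :
      IsBlockConcat (fun n ↦ (ω n : List (Fin s))) a ↔ a = encode Subtype.val hc ω := by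
    simp only [isBlockConcat_iff, eq_encode_iff, List.flatMap, initialWord, List.map_map,
      Function.comp_def]
  ext x
  constructor
  · rintro ⟨a, rfl, w, hw, ha⟩
    exact ⟨fun n ↦ ⟨w n, hw n⟩, congrArg _ (hconcat.mp ha).symm⟩
  · rintro ⟨ω, rfl⟩
    exact ⟨_, rfl, fun n ↦ ω n, fun n ↦ (ω n).2, hconcat.mpr rfl⟩

theorem sum_blockCount_mul {R : Type*} [CommSemiring R] {B : Finset (List (Fin s))}
    (hnil : [] ∉ B) (g : ℕ → R) :
    ∑ k ∈ Finset.Icc 1 (B.sup List.length), (blockCount B k : R) * g k =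
      ∑ σ ∈ B, g σ.length := by
  have hmaps : ∀ σ ∈ B, σ.length ∈ Finset.Icc 1 (B.sup List.length) := fun σ hσ ↦
    Finset.mem_Icc.mpr ⟨List.length_pos_iff.mpr fun h ↦ hnil (h ▸ hσ), Finset.le_sup hσ⟩
  rw [← Finset.sum_fiberwise_of_maps_to hmaps]
  refine Finset.sum_congr rfl fun k _ ↦ ?_
  rw [blockCount, ← nsmul_eq_mul, ← Finset.sum_const]
  exact Finset.sum_congr rfl fun σ hσ ↦ by rw [(Finset.mem_filter.mp hσ).2]

end BlockSet

section BlockMeasure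

variable {ι α : Type*} [MeasurableSpace ι] [MeasurableSingletonClass ι] {c : ι → List α}
  {q : PMF ι} {θ : ℝ≥0∞}

theorem infinitePi_initialWord_eq (hq : ∀ i, q i = θ ^ (c i).length) (ω : ℕ → ι) (p : ℕ) :
    Measure.infinitePi (fun _ : ℕ ↦ q.toMeasure) {ω' | initialWord ω' p = initialWord ω p} =
      θ ^ ((initialWord ω p).flatMap c).length := by
  have hcylinder : {ω' | initialWord ω' p = initialWord ω p} =
      Set.pi (Finset.range p) fun i ↦ {ω i} := by
    ext ω'
    simp [initialWord_inj, Set.mem_pi]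
  have hlen : ((initialWord ω p).flatMap c).length = ∑ i ∈ Finset.range p, (c (ω i)).length := by
    rw [← length_flatten_initialWord fun i ↦ c (ω i)]
    simp [initialWord, List.flatMap, Function.comp_def]
  rw [hcylinder, Measure.infinitePi_pi _ fun _ _ ↦ MeasurableSet.singleton _, hlen,
    ← Finset.prod_pow_eq_pow_sum]
  simp only [PMF.toMeasure_apply_singleton _ _ (MeasurableSet.singleton _), hq]

theorem infinitePi_exists_flatMap_eq_le (hq : ∀ i, q i = θ ^ (c i).length)
    (hdec : Function.Injective fun L : List ι ↦ L.flatMap c) (x : List α) :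
    Measure.infinitePi (fun _ : ℕ ↦ q.toMeasure) {ω | ∃ p, (initialWord ω p).flatMap c = x} ≤
      θ ^ x.length := by
  rcases {ω : ℕ → ι | ∃ p, (initialWord ω p).flatMap c = x}.eq_empty_or_nonempty with
    hempty | ⟨ω, p, rfl⟩
  · simp [hempty]
  rw [← infinitePi_initialWord_eq hq]
  refine measure_mono fun ω' ⟨p', hp'⟩ ↦ ?_
  have hword : initialWord ω' p' = initialWord ω p := hdec hp'
  obtain rfl : p' = p := by simpa using congrArg List.length hword
  exact hword

theorem infinitePi_initialWord_encode_eq_le [Finite α] (hc : ∀ i, c i ≠ []) {K : ℕ}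
    (hK : ∀ i, (c i).length ≤ K) (hθ : θ ≤ 1) (hq : ∀ i, q i = θ ^ (c i).length)
    (hdec : Function.Injective fun L : List ι ↦ L.flatMap c) (u : List α) :
    Measure.infinitePi (fun _ : ℕ ↦ q.toMeasure)
        {ω | initialWord (encode c hc ω) u.length = u} ≤
      {v : List α | v.length ≤ K}.ncard * θ ^ u.length := by
  rw [Set.ncard_eq_toFinset_card _ (List.finite_length_le α K)]
  let V := (List.finite_length_le α K).toFinset
  have hcover : {ω | initialWord (encode c hc ω) u.length = u} ⊆
      ⋃ v ∈ V, {ω | ∃ p, (initialWord ω p).flatMap c = u ++ v} := by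
    intro ω hω
    obtain ⟨p, v, hv, hp⟩ := exists_flatMap_initialWord_eq_append hc hK ω u.length
    refine Set.mem_iUnion₂.mpr ⟨v, by simpa [V] using hv, p, ?_⟩
    rw [hp, hω]
  calc Measure.infinitePi (fun _ : ℕ ↦ q.toMeasure) {ω | initialWord (encode c hc ω) u.length = u}
      ≤ ∑ v ∈ V, Measure.infinitePi (fun _ : ℕ ↦ q.toMeasure)
          {ω | ∃ p, (initialWord ω p).flatMap c = u ++ v} :=
        (measure_mono hcover).trans (measure_biUnion_finset_le V _)
    _ ≤ V.card • θ ^ u.length := Finset.sum_le_card_nsmul _ _ _ fun v _ ↦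
        (infinitePi_exists_flatMap_eq_le hq hdec _).trans
          (pow_le_pow_right_of_le_one' hθ (by simp))
    _ = V.card * θ ^ u.length := nsmul_eq_mul _ _

end BlockMeasure

section CodeDimension

variable {ι : Type*} {s : ℕ} {c : ι → List (Fin s)}

theorem ediam_image_ofDigits_encode_le (hs : 0 < s) (hc : ∀ i, c i ≠ []) (L : List ι) :
    Metric.ediam ((fun ω : ℕ → ι ↦ Real.ofDigits (encode c hc ω)) ''
      {ω | initialWord ω L.length = L}) ≤ (s : ℝ≥0∞)⁻¹ ^ (L.flatMap c).length := by
  have hprefix {ω : ℕ → ι} (hω : initialWord ω L.length = L) :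
      initialWord (encode c hc ω) (L.flatMap c).length = L.flatMap c := by
    simpa only [hω] using initialWord_encode hc ω L.length
  rw [Metric.ediam_image_le_iff]
  intro ω hω ω' hω'
  rw [edist_dist, Real.dist_eq, ← ofReal_inv_natCast_pow hs]
  exact ENNReal.ofReal_le_ofReal <| Real.abs_ofDigits_sub_ofDigits_le <|
    initialWord_inj.mp ((hprefix hω).trans (hprefix hω').symm)

variable [Fintype ι] {d : ℝ≥0}

theorem hausdorffMeasure_range_ofDigits_encode_ne_zero (hs : 1 < s) (hc : ∀ i, c i ≠ [])
    (hdec : Function.Injective fun L : List ι ↦ L.flatMap c)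
    (hd : ∑ i, ((s : ℝ≥0∞)⁻¹ ^ (d : ℝ)) ^ (c i).length = 1) :
    μH[d] (Set.range fun ω : ℕ → ι ↦ Real.ofDigits (encode c hc ω)) ≠ 0 := by
  let _ : MeasurableSpace ι := ⊤
  let P := Measure.infinitePi fun _ : ℕ ↦ (PMF.ofFintype _ hd).toMeasure
  have hencode : Measurable (encode c hc) := measurable_encode hc
  have hθ : (s : ℝ≥0∞)⁻¹ ^ (d : ℝ) ≤ 1 :=
    ENNReal.rpow_le_one (ENNReal.inv_le_one.mpr (by exact_mod_cast hs.le)) d.coe_nonneg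
  obtain ⟨K, hK⟩ := Finite.exists_le fun i ↦ (c i).length
  refine hausdorffMeasure_ne_zero_of_measure_initialWord_le hs (P := P.map (encode c hc))
    (C := {v : List (Fin s) | v.length ≤ K}.ncard) (by simp) d.coe_nonneg (fun n a ↦ ?_) ?_
  · have hmeas := measurableSet_initialWord_mem (ι := Fin s) n {initialWord a n}
    rw [Measure.map_apply hencode (by simpa using hmeas)]
    simpa using infinitePi_initialWord_encode_eq_le hc hK hθ (fun _ ↦ rfl) hdec (initialWord a n)
  · have hfull : encode c hc ⁻¹' (Real.ofDigits ⁻¹'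
        Set.range fun ω ↦ Real.ofDigits (encode c hc ω)) = Set.univ :=
      Set.eq_univ_of_forall fun ω ↦ Set.mem_range_self ω
    refine (LT.lt.trans_le ?_ (Measure.le_map_apply hencode.aemeasurable _)).ne'
    rw [hfull, measure_univ]
    exact one_pos

theorem hausdorffMeasure_range_ofDigits_encode_le_one (hs : 1 < s) (hc : ∀ i, c i ≠ [])
    (hd : ∑ i, ((s : ℝ≥0∞)⁻¹ ^ (d : ℝ)) ^ (c i).length = 1) :
    μH[d] (Set.range fun ω : ℕ → ι ↦ Real.ofDigits (encode c hc ω)) ≤ 1 := by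
  have hb : (s : ℝ≥0∞)⁻¹ < 1 := ENNReal.inv_lt_one.mpr (by exact_mod_cast hs)
  let cyl (p : ℕ) (t : Fin p → ι) : Set ℝ :=
    (fun ω ↦ Real.ofDigits (encode c hc ω)) '' {ω | initialWord ω p = List.ofFn t}
  have hdiam (p : ℕ) (t : Fin p → ι) :
      Metric.ediam (cyl p t) ≤ (s : ℝ≥0∞)⁻¹ ^ ((List.ofFn t).flatMap c).length := by
    simpa [cyl] using ediam_image_ofDigits_encode_le (by omega) hc (List.ofFn t)
  have hsmall (p : ℕ) (t : Fin p → ι) : Metric.ediam (cyl p t) ≤ (s : ℝ≥0∞)⁻¹ ^ p :=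
    (hdiam p t).trans <| pow_le_pow_right_of_le_one' hb.le <| by
      simpa using length_le_length_flatMap hc (List.ofFn t)
  have hcover (p : ℕ) :
      (Set.range fun ω ↦ Real.ofDigits (encode c hc ω)) ⊆ ⋃ t, cyl p t := by
    rintro _ ⟨ω, rfl⟩
    exact Set.mem_iUnion.mpr ⟨fun i ↦ ω i, ω, initialWord_eq_ofFn ω p, rfl⟩
  have hsum (p : ℕ) : ∑ t, Metric.ediam (cyl p t) ^ (d : ℝ) ≤ 1 :=
    calc ∑ t, Metric.ediam (cyl p t) ^ (d : ℝ)
        ≤ ∑ t : Fin p → ι, ((s : ℝ≥0∞)⁻¹ ^ (d : ℝ)) ^ ((List.ofFn t).flatMap c).length := by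
          gcongr with t
          rw [← ennreal_pow_rpow_comm]
          exact ENNReal.rpow_le_rpow (hdiam p t) d.coe_nonneg
      _ = 1 := by rw [sum_pow_length_flatMap_ofFn, hd, one_pow]
  calc μH[d] (Set.range fun ω ↦ Real.ofDigits (encode c hc ω))
      ≤ liminf (fun p ↦ ∑ t, Metric.ediam (cyl p t) ^ (d : ℝ)) atTop :=
        Measure.hausdorffMeasure_le_liminf_sum _ _ _
          (ENNReal.tendsto_pow_atTop_nhds_zero_of_lt_one hb) cyl (.of_forall hsmall)
          (.of_forall hcover)
    _ ≤ 1 := (liminf_le_liminf (.of_forall hsum)).trans_eq (liminf_const 1)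

theorem dimH_range_ofDigits_encode (hs : 1 < s) (hc : ∀ i, c i ≠ [])
    (hdec : Function.Injective fun L : List ι ↦ L.flatMap c)
    (hd : ∑ i, ((1 / s : ℝ) ^ (d : ℝ)) ^ (c i).length = 1) :
    dimH (Set.range fun ω : ℕ → ι ↦ Real.ofDigits (encode c hc ω)) = d := by
  have hweight : ENNReal.ofReal ((1 / s : ℝ) ^ (d : ℝ)) = (s : ℝ≥0∞)⁻¹ ^ (d : ℝ) := by
    rw [← ENNReal.ofReal_rpow_of_pos (by positivity), one_div,
      ENNReal.ofReal_inv_of_pos (by positivity), ENNReal.ofReal_natCast]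
  have hd' : ∑ i, ((s : ℝ≥0∞)⁻¹ ^ (d : ℝ)) ^ (c i).length = 1 := by
    simp only [← hweight, ← ENNReal.ofReal_pow (show 0 ≤ (1 / s : ℝ) ^ (d : ℝ) by positivity)]
    rw [← ENNReal.ofReal_sum_of_nonneg fun _ _ ↦ by positivity, hd, ENNReal.ofReal_one]
  exact dimH_of_hausdorffMeasure_ne_zero_ne_top
    (hausdorffMeasure_range_ofDigits_encode_ne_zero hs hc hdec hd')
    (ne_top_of_le_ne_top ENNReal.one_ne_top
      (hausdorffMeasure_range_ofDigits_encode_le_one hs hc hd'))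

end CodeDimension

section Equation

theorem exists_sum_rpow_pow_eq_one {ι : Type*} [Fintype ι] [Nonempty ι] {b : ℝ} (hb₀ : 0 < b)
    (hb₁ : b < 1) {ℓ : ι → ℕ} (hℓ : ∀ i, ℓ i ≠ 0) :
    ∃ d : ℝ≥0, ∑ i, (b ^ (d : ℝ)) ^ ℓ i = 1 := by
  have hcont : Continuous fun θ : ℝ ↦ ∑ i, θ ^ ℓ i := by fun_prop
  obtain ⟨θ, ⟨hθ₀, hθ₁⟩, hθ⟩ : ∃ θ ∈ Set.Icc (0 : ℝ) 1, ∑ i, θ ^ ℓ i = 1 :=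
    intermediate_value_Icc zero_le_one hcont.continuousOn
      ⟨by simp [hℓ], by simpa using Nat.one_le_iff_ne_zero.mpr (Fintype.card_ne_zero (α := ι))⟩
  have hθpos : 0 < θ := hθ₀.lt_of_ne' fun h ↦ by simp [h, hℓ] at hθ
  refine ⟨⟨Real.logb b θ, Real.logb_nonneg_of_base_lt_one hb₀ hb₁ hθpos hθ₁⟩, ?_⟩
  change ∑ i, (b ^ Real.logb b θ) ^ ℓ i = 1
  rwa [Real.rpow_logb hb₀ hb₁.ne hθpos]

end Equation

theorem theorem6 (s : ℕ) (hs : 1 < s) (B : Finset (List (Fin s))) (hne : B.Nonempty)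
    (hB : InformationTheory.UniquelyDecodable (B : Set (List (Fin s)))) :
    (∑ k ∈ Finset.Icc 1 (B.sup List.length), blockCount B k = B.card) ∧
    ∃ α₀ : NNReal, dimH (blockSet s B) = (α₀ : ENNReal) ∧
      ∑ k ∈ Finset.Icc 1 (B.sup List.length),
        (blockCount B k : ℝ) * ((1 : ℝ) / (s : ℝ)) ^ ((k : ℝ) * (α₀ : ℝ)) = 1 := by
  have hnil : [] ∉ B := by simpa using hB.epsilon_not_mem
  have hc (σ : B) : (σ : List (Fin s)) ≠ [] := fun h ↦ hnil (h ▸ σ.2)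
  have hdec : Function.Injective fun L : List B ↦ L.flatMap Subtype.val :=
    flatMap_injective_of_uniquelyDecodable Subtype.val_injective (by simpa using hB)
  have : Nonempty B := hne.to_subtype
  obtain ⟨α, hα⟩ := exists_sum_rpow_pow_eq_one (b := 1 / s) (by positivity)
    (by rw [one_div]; exact inv_lt_one_of_one_lt₀ (by exact_mod_cast hs))
    fun σ : B ↦ (List.length_pos_iff.mpr (hc σ)).ne'
  refine ⟨by simpa using sum_blockCount_mul hnil fun _ ↦ (1 : ℕ), α, ?_, ?_⟩
  · rw [blockSet_eq_range_ofDigits_encode hc, dimH_range_ofDigits_encode hs hc hdec hα]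
  · rw [sum_blockCount_mul hnil fun k ↦ ((1 : ℝ) / s) ^ ((k : ℝ) * α)]
    rw [Finset.sum_coe_sort B fun σ ↦ ((1 / s : ℝ) ^ (α : ℝ)) ^ σ.length] at hα
    refine (Finset.sum_congr rfl fun σ _ ↦ ?_).trans hα
    rw [mul_comm, Real.rpow_mul (by positivity), Real.rpow_natCast]
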